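/- Fix a dimension $d\ge 3$. A \emph{frame model} consists of a Euclidean ordered field $Q$ (a linearly ordered field in which positive elements have square roots), a set $B$ of bodies, subsets $\mathrm{IOb}\subseteq \mathrm{Ob}\subseteq B$ (inertial observers, observers) and $\mathrm{Ph}\subseteq B$ (photons), and a worldview relation $W\subseteq \mathrm{Ob}\times B\times Q^d$. For $p\in Q^d$ write $p_\tau=p_1$, $p_\sigma=(p_2,\dots,p_d)$, and $|\cdot|$ for Euclidean length; $o$ is the origin and $1_t=(1,0,\dots,0)$. Put $ev_m(p)=\{b: W(m,b,p)\}$, $Cd_m=\{p: ev_m(p)\ne\emptyset\}$, $Ev_m=\{ev_m(p): p\in Cd_m\}$, $wl_m(b)=\{p: W(m,b,p)\}$. If $e=ev_m(p)$ for exactly one $p$, put $time_m(e)=p_\tau$; put $time_m(e_1,e_2)=|time_m(e_1)-time_m(e_2)|$. Let $w^k_m(p)$ be the unique $q$ with $ev_k(p)=ev_m(q)\neq\emptyset$, if there is exactly one, and $1^k_m=w^k_m(1_t)-w^k_m(o)$. An equation or inequality (also as part of a longer formula) is true only if all terms in it are defined. Consider the following properties of frame models. - $\mathrm{AxSelf}_0$: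 for all $m\in \mathrm{Ob}$, $p\in Q^d$: $m\in ev_m(p)$ iff $p\in Cd_m$ and $p_\sigma=o$. - $\mathrm{AxPh}$: for all $m\in \mathrm{IOb}$, $p,q\in Q^d$: $|p_\sigma-q_\sigma|=|p_\tau-q_\tau|$ iff $\mathrm{Ph}\cap ev_m(p)\cap ev_m(q)\neq\emptyset$. - $\mathrm{AxEv}$: $Ev_m=Ev_k$ for all $m,k\in \mathrm{IOb}$. - $\mathrm{AxLinTime}$: for all $m,k\in \mathrm{IOb}$, $w^k_m(o)$ and $1^k_m$ are defined, $wl_m(k)=\{w^k_m(o)+\lambda 1^k_m:\lambda\in Q\}$, and $time_k(ev_m(p),ev_m(q))\cdot|1^k_m|=|p-q|$ for all $p,q\in wl_m(k)$. - $\mathrm{AxShift}$: for all $m,k\in \mathrm{IOb}$ and $p\in Cd_m$ there is $h\in \mathrm{IOb}$ with $h\in ev_m(p)$ and $1^k_m=1^h_m$. - $\mathrm{AxThExp}$: for all $m\in \mathrm{IOb}$ and $p,q\in Q^d$ with $|p_\sigma-q_\sigma|<|p_\tau-q_\tau|$ there is $k\in \mathrm{IOb}$ with $k\in ev_m(p)\cap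 ev_m(q)$. - $\mathrm{SlowTime}$: for all $m,k\in \mathrm{IOb}$, if $wl_m(k)\ne wl_m(m)$ then $|(1^k_m)_\tau|>1$. - $\mathrm{CP}$: for all $m,a,b,c\in \mathrm{IOb}$ and $e_a,e,e_c\in Ev_m$, if $a\in e_a\cap e$, $b\in e_a\cap e_c$, $c\in e\cap e_c$, $b\notin e$, and either $time_m(e_a)<time_m(e)<time_m(e_c)$ or $time_m(e_a)>time_m(e)>time_m(e_c)$, then $time_a(e_a,e)+time_c(e,e_c)<time_b(e_a,e_c)$. Let $\mathrm{SpecRel}_0=\{\mathrm{AxSelf}_0,\mathrm{AxPh},\mathrm{AxEv}\}$, and write $\Sigma\models\varphi$ if $\varphi$ holds in every frame model (of dimension $d$) in which all members of $\Sigma$ hold. **Theorem.** For every $d\ge3$, $$\mathrm{SpecRel}_0+\mathrm{AxLinTime}+\mathrm{SlowTime}\models \mathrm{CP},$$ but $$\mathrm{SpecRel}_0+\mathrm{AxLinTime}+\mathrm{AxShift}+\mathrm{AxThExp}+\mathrm{CP}\not\models \mathrm{SlowTime}.$$ -/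

import Mathlib

/-!
First-order spacetime frame. Time is coordinate `0`, the space coordinates are `1, …, n`, so the
dimension of spacetime is `d = n + 1`. Expressions of the theory that may be undefined (locations,
times, values of worldview transformations, time-unit vectors) are given as functional relations,
and an atomic formula containing such expressions holds only if all of them are defined
(existential equality).
-/

universe u v

/-- A (two-sorted) model of the frame language: a Euclidean ordered field `Q` of quantities, a sort
of bodies, observers, inertial observers, photons, and the worldview relation `W m b p`
("observer `m` coordinatizes body `b` at the coordinate point `p`"). -/
structure FrameModel (n : ℕ) where
  /-- quantities -/
  Q : Type u
  [fieldQ : Field Q]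
  [linearOrderQ : LinearOrder Q]
  [orderedQ : IsStrictOrderedRing Q]
  /-- positive quantities have square roots -/
  exists_sqrt : ∀ x : Q, 0 < x → ∃ y : Q, y * y = x
  /-- bodies -/
  Body : Type v
  /-- observers -/
  Ob : Set Body
  /-- inertial observers -/
  IOb : Set Body
  /-- photons -/
  Ph : Set Body
  iob_subset : IOb ⊆ Ob
  /-- the worldview relation -/
  W : Body → Body → (Fin (n + 1) → Q) → Prop
  w_observer : ∀ m b p, W m b p → m ∈ Ob

namespace FrameModel

attribute [instance] FrameModel.fieldQ FrameModel.linearOrderQ FrameModel.orderedQ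

variable {n : ℕ} (M : FrameModel.{u, v} n)

/-- Coordinate points. -/
abbrev Pt : Type u := Fin (n + 1) → M.Q

/-- Events are sets of bodies. -/
abbrev Event : Type v := Set M.Body

theorem exists_len {k : ℕ} (x : Fin k → M.Q) :
    ∃ r : M.Q, 0 ≤ r ∧ r * r = ∑ i, x i * x i := by
  have h0 : 0 ≤ ∑ i, x i * x i := Finset.sum_nonneg fun i _ => mul_self_nonneg (x i)
  rcases h0.eq_or_lt with h | h
  · exact ⟨0, le_rfl, by simpa using h⟩
  · obtain ⟨y, hy⟩ := M.exists_sqrt _ h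
    exact ⟨|y|, abs_nonneg y, by rw [abs_mul_abs_self, hy]⟩

/-- Euclidean length: the nonnegative square root of the sum of the squares of the coordinates. -/
noncomputable def len {k : ℕ} (x : Fin k → M.Q) : M.Q := Classical.choose (M.exists_len x)

theorem len_nonneg {k : ℕ} (x : Fin k → M.Q) : 0 ≤ M.len x :=
  (Classical.choose_spec (M.exists_len x)).1

theorem len_mul_self {k : ℕ} (x : Fin k → M.Q) : M.len x * M.len x = ∑ i, x i * x i :=
  (Classical.choose_spec (M.exists_len x)).2

/-- The time component of a coordinate point. -/
def tm (p : M.Pt) : M.Q := p 0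

/-- The space component of a coordinate point. -/
def sp (p : M.Pt) : Fin n → M.Q := fun i => p i.succ

/-- The first standard basis vector `⟨1, 0, …, 0⟩`. -/
def oneT : M.Pt := Pi.single 0 1

/-- The event observed by `m` at `p`: the set of bodies that `m` coordinatizes at `p`. -/
def ev (m : M.Body) (p : M.Pt) : M.Event := {b | M.W m b p}

/-- The set of nonempty events coordinatized by `m`. -/
def Ev (m : M.Body) : Set M.Event := {e | e.Nonempty ∧ ∃ p, M.ev m p = e}

/-- The coordinate domain of `m`. -/
def Cd (m : M.Body) : Set M.Pt := {p | (M.ev m p).Nonempty}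

/-- The world-line of body `b` according to `m`. -/
def wl (m b : M.Body) : Set M.Pt := {p | M.W m b p}

/-- `loc_m(e)` is defined and equals `p`. -/
def IsLoc (m : M.Body) (e : M.Event) (p : M.Pt) : Prop :=
  M.ev m p = e ∧ ∀ q, M.ev m q = e → q = p

/-- `time_m(e)` is defined and equals `t`. -/
def IsTime (m : M.Body) (e : M.Event) (t : M.Q) : Prop :=
  ∃ p, M.IsLoc m e p ∧ t = M.tm p

/-- The elapsed time `time_m(e₁, e₂)` is defined and equals `t`. -/
def IsElapsed (m : M.Body) (e₁ e₂ : M.Event) (t : M.Q) : Prop :=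
  ∃ t₁ t₂, M.IsTime m e₁ t₁ ∧ M.IsTime m e₂ t₂ ∧ t = |t₁ - t₂|

/-- The worldview transformation between `k` and `m`, as a binary relation: `k` at `p` and `m` at
`q` coordinatize the same nonempty event. -/
def Wv (k m : M.Body) (p q : M.Pt) : Prop :=
  M.ev k p = M.ev m q ∧ (M.ev k p).Nonempty

/-- The value at `p` of the worldview transformation between `k` and `m` exists, is unique, and
equals `q`. -/
def IsWv (k m : M.Body) (p q : M.Pt) : Prop :=
  M.Wv k m p q ∧ ∀ q', M.Wv k m p q' → q' = q

/-- The time-unit vector of `k` according to `m` is defined and equals `x`. -/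
def IsTimeUnit (k m : M.Body) (x : M.Pt) : Prop :=
  ∃ q₁ q₀, M.IsWv k m M.oneT q₁ ∧ M.IsWv k m 0 q₀ ∧ x = q₁ - q₀

/-- An observer coordinatizes itself at a coordinate point iff the point is in its coordinate
domain and has space component the origin. -/
def AxSelf0 : Prop :=
  ∀ m ∈ M.Ob, ∀ p : M.Pt, m ∈ M.ev m p ↔ p ∈ M.Cd m ∧ M.sp p = 0

/-- For every inertial observer there is a photon through two coordinate points iff the slope of
their difference is `1`. -/
def AxPh : Prop :=
  ∀ m ∈ M.IOb, ∀ p q : M.Pt,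
    M.len (M.sp p - M.sp q) = |M.tm p - M.tm q| ↔ (M.Ph ∩ M.ev m p ∩ M.ev m q).Nonempty

/-- All inertial observers coordinatize the same events. -/
def AxEv : Prop := ∀ m ∈ M.IOb, ∀ k ∈ M.IOb, M.Ev m = M.Ev k

/-- The world-lines of inertial observers are lines and time elapses uniformly on them. -/
def AxLinTime : Prop :=
  ∀ m ∈ M.IOb, ∀ k ∈ M.IOb, ∃ q₀ x : M.Pt, M.IsWv k m 0 q₀ ∧ M.IsTimeUnit k m x ∧
    M.wl m k = {p | ∃ c : M.Q, p = q₀ + c • x} ∧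
    ∀ p ∈ M.wl m k, ∀ q ∈ M.wl m k, ∃ t, M.IsElapsed k (M.ev m p) (M.ev m q) t ∧
      t * M.len x = M.len (p - q)

/-- An inertial observer observing an inertial observer `k` also observes, at each point of its
coordinate domain, an inertial observer with the same time-unit vector as `k`. -/
def AxShift : Prop :=
  ∀ m ∈ M.IOb, ∀ k ∈ M.IOb, ∀ p ∈ M.Cd m, ∃ h ∈ M.IOb, h ∈ M.ev m p ∧
    ∃ x, M.IsTimeUnit k m x ∧ M.IsTimeUnit h m x

/-- Inertial observers can move in any direction at any speed slower than `1`. -/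
def AxThExp : Prop :=
  ∀ m ∈ M.IOb, ∀ p q : M.Pt, M.len (M.sp p - M.sp q) < |M.tm p - M.tm q| →
    ∃ k ∈ M.IOb, k ∈ M.ev m p ∩ M.ev m q

/-- Clocks of relatively moving inertial observers slow down. -/
def SlowTime : Prop :=
  ∀ m ∈ M.IOb, ∀ k ∈ M.IOb, M.wl m k ≠ M.wl m m →
    ∃ x, M.IsTimeUnit k m x ∧ 1 < |M.tm x|

/-- `m` observes `a`, `b`, `c` in a clock paradox situation at the events `ea`, `e`, `ec`. -/
def CPSituation (m a b c : M.Body) (ea e ec : M.Event) : Prop :=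
  a ∈ ea ∩ e ∧ b ∈ ea ∩ ec ∧ c ∈ e ∩ ec ∧ b ∉ e ∧
    ∃ ta t tc, M.IsTime m ea ta ∧ M.IsTime m e t ∧ M.IsTime m ec tc ∧
      ((ta < t ∧ t < tc) ∨ (ta > t ∧ t > tc))

/-- `time_a(ea, e) + time_c(e, ec) < time_b(ea, ec)`, all three elapsed times being defined. -/
def TimeLess (a b c : M.Body) (ea e ec : M.Event) : Prop :=
  ∃ r s t, M.IsElapsed a ea e r ∧ M.IsElapsed c e ec s ∧ M.IsElapsed b ea ec t ∧ r + s < t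

/-- The clock paradox: in every clock paradox situation, less time elapses along the broken path. -/
def CP : Prop :=
  ∀ m ∈ M.IOb, ∀ c ∈ M.IOb, ∀ a ∈ M.IOb, ∀ b ∈ M.IOb,
    ∀ e ∈ M.Ev m, ∀ ea ∈ M.Ev m, ∀ ec ∈ M.Ev m,
      M.CPSituation m a b c ea e ec → M.TimeLess a b c ea e ec

/-- The theory `SpecRel₀`, as a set of properties of models. -/
def SpecRel0 (n : ℕ) : Set (FrameModel.{u, v} n → Prop) := {AxSelf0, AxPh, AxEv}

/-- Logical consequence: `φ` is true in every model of the theory `T`. -/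
def Entails {n : ℕ} (T : Set (FrameModel.{u, v} n → Prop)) (φ : FrameModel.{u, v} n → Prop) :
    Prop :=
  ∀ M : FrameModel.{u, v} n, (∀ ψ ∈ T, ψ M) → φ M

end FrameModel

/-! Positive half. By `AxPh` and `AxEv` the worldview transformations between inertial observers are
bijections preserving the relation "joined by a photon". Timelike separation and temporal
betweenness of timelike related points are definable from that relation (`timelike_iff_null`,
`between_iff_null`), so they are preserved too, and no linearity of the transformations is needed.
Hence in a clock paradox situation the middle event lies between the other two also in the
coordinates of `b`. Since `a` and `c` pass through that event and `b` does not, both move relative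
to `b`; `SlowTime` with `AxLinTime` makes each of their elapsed times smaller than the coordinate
time of `b`, and the coordinate times of the two legs add up.

Negative half. In real Minkowski spacetime, clocks measure a displacement `v` by `form v v / |v 0|`
instead of by the square root of `form v v`. This quantity is homogeneous and strictly superadditive
on nonparallel displacements of one time orientation (`form_div_add_lt`), which gives `CP`. A moving
frame, however, assigns to the time unit of the standard observer a time component of absolute value
exactly `1`, so `SlowTime` fails. -/

/-! ### The Minkowski form -/

namespace Minkowski

open Finset

section Form

variable {K : Type*} [Field K] {n : ℕ}

/-- The Minkowski form, of signature `(+, -, …, -)`. -/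
def form : LinearMap.BilinForm K (Fin (n + 1) → K) :=
  LinearMap.mk₂ K (fun x y => x 0 * y 0 - ∑ i : Fin n, x i.succ * y i.succ)
    (fun x y z => by simp only [Pi.add_apply, add_mul, sum_add_distrib]; ring)
    (fun c x y => by simp only [Pi.smul_apply, smul_eq_mul, mul_assoc, ← mul_sum]; ring)
    (fun x y z => by simp only [Pi.add_apply, mul_add, sum_add_distrib]; ring)
    (fun c x y => by
      simp only [Pi.smul_apply, smul_eq_mul, mul_left_comm _ c, ← mul_sum]; ring)

theorem form_apply (x y : Fin (n + 1) → K) :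
    form x y = x 0 * y 0 - ∑ i : Fin n, x i.succ * y i.succ := rfl

theorem form_comm (x y : Fin (n + 1) → K) : form x y = form y x := by
  simp only [form_apply, mul_comm]

theorem form_sub_self (x y : Fin (n + 1) → K) :
    form (x - y) (x - y) = form x x - 2 * form x y + form y y := by
  simp only [map_sub, LinearMap.sub_apply, form_comm y x]; ring

theorem form_add_self (x y : Fin (n + 1) → K) :
    form (x + y) (x + y) = form x x + 2 * form x y + form y y := by
  simp only [map_add, LinearMap.add_apply, form_comm y x]; ring

theorem form_smul_self (c : K) (x : Fin (n + 1) → K) :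
    form (c • x) (c • x) = c * c * form x x := by
  simp only [map_smul, LinearMap.smul_apply, smul_eq_mul]; ring

theorem form_sub_swap (x y : Fin (n + 1) → K) :
    form (x - y) (x - y) = form (y - x) (y - x) := by
  rw [form_sub_self, form_sub_self, form_comm y x]; ring

theorem form_single_zero (x : Fin (n + 1) → K) : form x (Pi.single 0 1) = x 0 := by
  simp [form_apply]

/-- The null vector with time component `1` and space component `c • e i`, where `c = ± 1`. -/
theorem form_single_add (x : Fin (n + 1) → K) (i : Fin n) (c : K) :
    form x (Pi.single 0 1 + c • Pi.single i.succ 1) = x 0 - c * x i.succ := by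
  rw [map_add, map_smul, form_single_zero]
  have : form x (Pi.single i.succ 1) = - x i.succ := by
    simp [form_apply, Pi.single_apply, Fin.succ_inj]
  rw [this, smul_eq_mul]; ring

theorem form_single_add_self (i : Fin n) {c : K} (hc : c * c = 1) :
    form (Pi.single 0 1 + c • Pi.single i.succ 1 : Fin (n + 1) → K)
      (Pi.single 0 1 + c • Pi.single i.succ 1) = 0 := by
  rw [form_single_add]
  simp [Fin.succ_ne_zero, hc, (Fin.succ_ne_zero _).symm]

/-- Being connectible by a photon. -/
def Null (p q : Fin (n + 1) → K) : Prop := form (p - q) (p - q) = 0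

/-- Being timelike separated. -/
def Timelike [LinearOrder K] (p q : Fin (n + 1) → K) : Prop := 0 < form (p - q) (p - q)

theorem Timelike.symm [LinearOrder K] {p q : Fin (n + 1) → K} (h : Timelike p q) : Timelike q p := by
  rwa [Timelike, form_sub_swap]

end Form

variable {K : Type*} [Field K] [LinearOrder K] [IsStrictOrderedRing K] {n : ℕ}

theorem form_self_nonpos {x : Fin (n + 1) → K} (h : x 0 = 0) : form x x ≤ 0 := by
  rw [form_apply, h]
  have : 0 ≤ ∑ i : Fin n, x i.succ * x i.succ := sum_nonneg fun i _ => mul_self_nonneg _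
  linarith

theorem eq_zero_of_form_self {x : Fin (n + 1) → K} (h : x 0 = 0) (hx : 0 ≤ form x x) :
    x = 0 := by
  rw [form_apply, h] at hx
  have h0 : 0 ≤ ∑ i : Fin n, x i.succ * x i.succ := sum_nonneg fun i _ => mul_self_nonneg _
  have h1 : ∑ i : Fin n, x i.succ * x i.succ = 0 := by linarith
  rw [sum_eq_zero_iff_of_nonneg fun i _ => mul_self_nonneg _] at h1
  funext i
  refine Fin.cases h (fun j => ?_) i
  simpa using h1 j (mem_univ j)

theorem time_ne_zero {x : Fin (n + 1) → K} (hx : 0 ≤ form x x) (h : x ≠ 0) : x 0 ≠ 0 :=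
  fun h0 => h (eq_zero_of_form_self h0 hx)

theorem time_ne_zero_of_pos {x : Fin (n + 1) → K} (hx : 0 < form x x) : x 0 ≠ 0 :=
  time_ne_zero hx.le (by rintro rfl; simp at hx)

/-- Two orthogonal null vectors are parallel. -/
theorem eq_smul_of_null {u v : Fin (n + 1) → K} (hu : form u u = 0) (hv : form v v = 0)
    (huv : form u v = 0) (h : v ≠ 0) : u = (u 0 / v 0) • v := by
  have hv0 := time_ne_zero hv.ge h
  -- The difference is null and has time component zero, hence vanishes.
  rw [← sub_eq_zero]
  apply eq_zero_of_form_self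
  · simp [hv0]
  · rw [form_sub_self, form_smul_self, map_smul, hu, hv, huv]; simp

/-- A timelike and a causal vector have positive product if they have the same time orientation,
and negative product otherwise. -/
theorem time_mul_time_mul_form_pos {u v : Fin (n + 1) → K} (hu : 0 < form u u)
    (hv : 0 ≤ form v v) (h : v ≠ 0) : 0 < u 0 * v 0 * form u v := by
  have hv0 := time_ne_zero hv h
  -- This combination has time component zero; expanding its square isolates the mixed term.
  have hw := form_self_nonpos (x := v 0 • u - u 0 • v) (by simp [mul_comm])
  rw [form_sub_self, form_smul_self, form_smul_self, map_smul, map_smul] at hw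
  simp only [LinearMap.smul_apply, smul_eq_mul] at hw
  have h1 : 0 < v 0 * v 0 * form u u := mul_pos (mul_self_pos.2 hv0) hu
  have h2 : 0 ≤ u 0 * u 0 * form v v := mul_nonneg (mul_self_nonneg _) hv
  linarith

theorem form_ne_zero {u v : Fin (n + 1) → K} (hu : 0 < form u u)
    (hv : 0 ≤ form v v) (h : v ≠ 0) : form u v ≠ 0 := fun h0 => by
  simpa [h0] using time_mul_time_mul_form_pos hu hv h

/-! ### Causal structure recovered from light cones -/

/-- A light cone determines its vertex: comparing `r = p` with `r = p + v` shows that `q - p` is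
orthogonal to every null `v`, and the null vectors with space part `± e i` span. -/
theorem eq_of_null_iff (hn : 0 < n) {p q : Fin (n + 1) → K}
    (h : ∀ r, Null p r ↔ Null q r) : p = q := by
  have key : ∀ v, form v v = 0 → form (q - p) v = 0 := by
    intro v hv
    have h0 : form (q - p) (q - p) = 0 := (h p).1 (by simp [Null])
    have h1 : form (q - (p + v)) (q - (p + v)) = 0 := (h (p + v)).1 (by simp [Null, hv])
    rw [← sub_sub, form_sub_self, h0, hv] at h1
    linarith
  have key' : ∀ i : Fin n, (q - p) 0 = 0 ∧ (q - p) i.succ = 0 := by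
    intro i
    have h1 := key _ (form_single_add_self i (c := 1) (by ring))
    have h2 := key _ (form_single_add_self i (c := -1) (by ring))
    rw [form_single_add] at h1 h2
    constructor <;> linarith
  symm
  rw [← sub_eq_zero]
  funext i
  exact Fin.cases (key' ⟨0, hn⟩).1 (fun j => (key' j).2) i

/-- In at least two space dimensions, every spacelike vector is orthogonal to a null vector. -/
theorem exists_null_orthogonal (hs : ∀ x : K, 0 < x → ∃ y : K, y * y = x) (hn : 2 ≤ n)
    {u : Fin (n + 1) → K} (hu : form u u < 0) : ∃ v, v ≠ 0 ∧ form v v = 0 ∧ form u v = 0 := by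
  set s : Fin n → K := fun i => u i.succ with hsdef
  have hS : u 0 * u 0 < s ⬝ᵥ s := by
    rw [form_apply] at hu
    simpa [dotProduct, hsdef, sub_neg] using hu
  have hS0 : 0 < s ⬝ᵥ s := (mul_self_nonneg _).trans_lt hS
  obtain ⟨i, hi⟩ : ∃ i, s i ≠ 0 := by
    by_contra! h
    have : s = 0 := funext h
    simp [this] at hS0
  obtain ⟨j, hj⟩ : ∃ j : Fin n, j ≠ i := by
    have : Nontrivial (Fin n) := Fin.nontrivial_iff_two_le.2 hn
    exact exists_ne i
  -- The second space dimension supplies a nonzero `z` orthogonal to `s`.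
  set z : Fin n → K := s j • Pi.single i 1 - s i • Pi.single j 1 with hz
  have hsz : s ⬝ᵥ z = 0 := by
    simp [hz, mul_comm]
  have hzz : 0 < z ⬝ᵥ z := by
    have : z ⬝ᵥ z = s i * s i + s j * s j := by
      simp [hz, hj, hj.symm]
      ring
    rw [this]
    exact add_pos_of_pos_of_nonneg (mul_self_pos.2 hi) (mul_self_nonneg _)
  -- `β` is chosen so that `w` below, whose product with `s` is `u 0`, is a unit vector; then `(1,
  -- w)` is null and orthogonal to `u`.
  obtain ⟨β, hβ⟩ := hs ((1 - u 0 * u 0 / (s ⬝ᵥ s)) / (z ⬝ᵥ z))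
    (div_pos (sub_pos.2 ((div_lt_one hS0).2 hS)) hzz)
  set w : Fin n → K := (u 0 / (s ⬝ᵥ s)) • s + β • z with hw
  have h1 : s ⬝ᵥ w = u 0 := by
    rw [hw, dotProduct_add, dotProduct_smul, dotProduct_smul, hsz]
    simp [hS0.ne']
  have h2 : w ⬝ᵥ w = 1 := by
    have : w ⬝ᵥ w = u 0 / (s ⬝ᵥ s) * (s ⬝ᵥ w) + β * (β * (z ⬝ᵥ z)) := by
      conv_lhs => rw [hw]
      rw [← hw, add_dotProduct, smul_dotProduct, smul_dotProduct, smul_eq_mul, smul_eq_mul]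
      congr 2
      rw [hw, dotProduct_add, dotProduct_smul, dotProduct_smul, dotProduct_comm z s, hsz]
      simp
    rw [this, h1, ← mul_assoc, hβ]
    field_simp
    ring
  refine ⟨Fin.cons 1 w, fun h => ?_, ?_, ?_⟩
  · simpa using congrFun h 0
  · rw [form_apply]
    simpa [sub_eq_zero, dotProduct] using h2.symm
  · rw [form_apply]
    simpa [sub_eq_zero, dotProduct] using h1.symm

/-- Being timelike separated is definable from being connectible by a photon. -/
theorem timelike_iff_null (hs : ∀ x : K, 0 < x → ∃ y : K, y * y = x) (hn : 2 ≤ n)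
    (p q : Fin (n + 1) → K) :
    Timelike p q ↔ ¬ Null p q ∧
      ∀ p', Null p' p → p' ≠ p → ∃ r, Null r p ∧ Null r p' ∧ Null r q := by
  constructor
  · intro h
    refine ⟨h.ne', fun p' hp' hne => ?_⟩
    have h' : 0 < form (q - p) (q - p) := h.symm
    have hv : form (p' - p) (p' - p) = 0 := hp'
    have hne' := form_ne_zero h' hv.ge (sub_ne_zero.2 hne)
    set u := q - p with hu
    set v := p' - p with hvd
    -- The null line through `p` and `p'` meets the light cone of `q`: for null `v` the equation
    -- `form (u - c • v) (u - c • v) = 0` is linear in `c`.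
    refine ⟨p + (form u u / (2 * form u v)) • v, ?_, ?_, ?_⟩
    · rw [Null, add_sub_cancel_left, form_smul_self, hv, mul_zero]
    · have : p + (form u u / (2 * form u v)) • v - p' = (form u u / (2 * form u v) - 1) • v := by
        rw [hvd]; module
      rw [Null, this, form_smul_self, hv, mul_zero]
    · have : p + (form u u / (2 * form u v)) • v - q = (form u u / (2 * form u v)) • v - u := by
        rw [hu]; module
      rw [Null, this, form_sub_swap, form_sub_self, form_smul_self, hv, map_smul, smul_eq_mul]
      field_simp
      ring
  · rintro ⟨h1, h2⟩
    by_contra h3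
    have h4 : form (q - p) (q - p) < 0 := by
      rw [form_sub_swap]
      exact lt_of_le_of_ne (not_lt.1 h3) h1
    -- Along a null line orthogonal to `q - p` the separation from `q` is constantly spacelike, so
    -- no `r` on it is null related to `q`; being null related to `p` and `p + v` forces `r` onto
    -- this line.
    obtain ⟨v, hv0, hv, huv⟩ := exists_null_orthogonal hs hn h4
    obtain ⟨r, hr1, hr2, hr3⟩ := h2 (p + v) (by simp [Null, hv]) (by simpa using hv0)
    have hr1 : form (r - p) (r - p) = 0 := hr1
    have hrv : form (r - p) v = 0 := by
      have : form (r - (p + v)) (r - (p + v)) = 0 := hr2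
      rw [← sub_sub, form_sub_self, hr1, hv] at this
      linarith
    have hrq : form (r - q) (r - q) = 0 := hr3
    have e := eq_smul_of_null hr1 hv hrv hv0
    have : r - q = ((r - p) 0 / v 0) • v - (q - p) := by rw [← e]; abel
    rw [this, form_sub_swap, form_sub_self, form_smul_self, hv, map_smul, huv] at hrq
    exact h4.ne (by simpa only [smul_zero, mul_zero, sub_zero, add_zero] using hrq)

/-- The time component of `y` is strictly between those of `x` and `z`. -/
def Between (x y z : Fin (n + 1) → K) : Prop := (x 0 < y 0 ∧ y 0 < z 0) ∨ (x 0 > y 0 ∧ y 0 > z 0)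

theorem between_iff_mul_neg (x y z : Fin (n + 1) → K) :
    Between x y z ↔ (x - y) 0 * (z - y) 0 < 0 := by
  simp only [Between, mul_neg_iff, Pi.sub_apply, sub_pos, sub_neg]
  tauto

/-- Causal betweenness is definable from the null and timelike relations. -/
theorem between_iff_null (hn : 0 < n) {x y z : Fin (n + 1) → K} (hx : Timelike x y)
    (hz : Timelike z y) :
    Between x y z ↔ ∀ w, Null w y → Timelike x w ∨ Timelike z w := by
  have hu : 0 < form (x - y) (x - y) := hx
  have hu' : 0 < form (z - y) (z - y) := hz
  have ex : ∀ w, Timelike x w ↔ 0 < form ((x - y) - (w - y)) ((x - y) - (w - y)) := fun w => by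
    rw [sub_sub_sub_cancel_right, Timelike]
  have ez : ∀ w, Timelike z w ↔ 0 < form ((z - y) - (w - y)) ((z - y) - (w - y)) := fun w => by
    rw [sub_sub_sub_cancel_right, Timelike]
  rw [between_iff_mul_neg]
  simp only [ex, ez]
  set u := x - y
  set u' := z - y
  constructor
  · intro h w hw
    have hv : form (w - y) (w - y) = 0 := hw
    set v := w - y
    rw [form_sub_self u v, form_sub_self u' v, hv]
    by_cases hv0 : v = 0
    · left; simpa [hv0] using hu
    have h1 := time_mul_time_mul_form_pos hu hv.ge hv0
    have h2 := time_mul_time_mul_form_pos hu' hv.ge hv0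
    by_contra! hc
    -- If neither separation is timelike, `u` and `u'` both have the time orientation of `v`,
    -- contrary to betweenness.
    have h3 : 0 < form u v := by linarith
    have h4 : 0 < form u' v := by linarith
    have h5 := pos_of_mul_pos_left h1 h3.le
    have h6 := pos_of_mul_pos_left h2 h4.le
    have := mul_pos h5 h6
    nlinarith [mul_self_nonneg (v 0)]
  · intro h
    by_contra hc
    have hc : 0 < u 0 * u' 0 := lt_of_le_of_ne (not_lt.1 hc)
      (mul_ne_zero (time_ne_zero_of_pos hu) (time_ne_zero_of_pos hu')).symm
    set v : Fin (n + 1) → K := Pi.single 0 1 + (1 : K) • Pi.single (Fin.succ ⟨0, hn⟩) 1 with hvd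
    have hv : form v v = 0 := form_single_add_self _ (by ring)
    have hv0 : v 0 = 1 := by simp [hvd]
    have hvne : v ≠ 0 := fun h => by simp [h] at hv0
    have h1 := time_mul_time_mul_form_pos hu hv.ge hvne
    have h2 := time_mul_time_mul_form_pos hu' hv.ge hvne
    rw [hv0, mul_one] at h1 h2
    have h3 : 0 < form u v * form u' v := by
      have h12 := mul_pos h1 h2
      rw [mul_mul_mul_comm] at h12
      exact pos_of_mul_pos_right h12 hc.le
    have hne := left_ne_zero_of_mul h3.ne'
    have hne' := right_ne_zero_of_mul h3.ne'
    -- The summands are the parameters where the null line meets the light cones of `x` and `z`.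
    -- They have the same sign, so their sum lies beyond both, where neither separation is timelike.
    set c : K := form u u / (2 * form u v) + form u' u' / (2 * form u' v) with hcd
    have hcv : form (c • v) (c • v) = 0 := by rw [form_smul_self, hv, mul_zero]
    have h4 := h (y + c • v) (by rw [Null, add_sub_cancel_left, hcv])
    rw [add_sub_cancel_left, form_sub_self u, form_sub_self u', hcv, map_smul, map_smul, smul_eq_mul,
      smul_eq_mul] at h4
    rcases h4 with h4 | h4
    · have : form u u - 2 * (c * form u v) + 0
          = - (form u' u' * (form u v * form u' v) / (form u' v * form u' v)) := by
        rw [hcd]; field_simp; ring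
      rw [this] at h4
      have : 0 ≤ form u' u' * (form u v * form u' v) / (form u' v * form u' v) :=
        div_nonneg (mul_nonneg hu'.le h3.le) (mul_self_nonneg _)
      linarith
    · have : form u' u' - 2 * (c * form u' v) + 0
          = - (form u u * (form u v * form u' v) / (form u v * form u v)) := by
        rw [hcd]; field_simp; ring
      rw [this] at h4
      have : 0 ≤ form u u * (form u v * form u' v) / (form u v * form u v) :=
        div_nonneg (mul_nonneg hu.le h3.le) (mul_self_nonneg _)
      linarith

section Transfer

variable {f : (Fin (n + 1) → K) → (Fin (n + 1) → K)}

theorem injective_of_null (hn : 0 < n) (hnull : ∀ p q, Null p q ↔ Null (f p) (f q)) :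
    Function.Injective f := fun p q h => eq_of_null_iff hn fun r => by rw [hnull, h, ← hnull]

theorem timelike_transfer (hs : ∀ x : K, 0 < x → ∃ y : K, y * y = x) (hn : 2 ≤ n)
    (hf : Function.Surjective f) (hnull : ∀ p q, Null p q ↔ Null (f p) (f q))
    (p q : Fin (n + 1) → K) : Timelike p q ↔ Timelike (f p) (f q) := by
  have hinj := injective_of_null (by omega) hnull
  rw [timelike_iff_null hs hn (f p), hf.forall, timelike_iff_null hs hn p, ← hnull]
  refine and_congr Iff.rfl (forall_congr' fun p' => ?_)
  rw [← hnull, hinj.ne_iff]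
  refine imp_congr Iff.rfl (imp_congr Iff.rfl (Iff.trans (exists_congr fun r => ?_)
    (hf.exists (p := fun r => Null r (f p) ∧ Null r (f p') ∧ Null r (f q))).symm))
  rw [← hnull, ← hnull, ← hnull]

theorem between_transfer (hs : ∀ x : K, 0 < x → ∃ y : K, y * y = x) (hn : 2 ≤ n)
    (hf : Function.Surjective f) (hnull : ∀ p q, Null p q ↔ Null (f p) (f q))
    {x y z : Fin (n + 1) → K} (hx : Timelike x y) (hz : Timelike z y) (h : Between x y z) :
    Between (f x) (f y) (f z) := by
  have ht := timelike_transfer hs hn hf hnull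
  rw [between_iff_null (by omega) hx hz] at h
  rw [between_iff_null (by omega) ((ht _ _).1 hx) ((ht _ _).1 hz), hf.forall]
  simpa only [← hnull, ← ht] using h

end Transfer

end Minkowski

/-! ### Worldview transformations between inertial observers -/

namespace FrameModel

open Minkowski

variable {n : ℕ} {M : FrameModel.{u, v} n}

theorem form_sub_eq (p q : M.Pt) :
    form (p - q) (p - q) = |M.tm p - M.tm q| * |M.tm p - M.tm q|
      - M.len (M.sp p - M.sp q) * M.len (M.sp p - M.sp q) := by
  rw [len_mul_self, abs_mul_abs_self]
  rfl

theorem len_eq_iff_null (p q : M.Pt) :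
    M.len (M.sp p - M.sp q) = |M.tm p - M.tm q| ↔ Null p q := by
  rw [Null, form_sub_eq, sub_eq_zero, eq_comm, mul_self_inj (abs_nonneg _) (M.len_nonneg _)]

theorem len_lt_iff_timelike (p q : M.Pt) :
    M.len (M.sp p - M.sp q) < |M.tm p - M.tm q| ↔ Timelike p q := by
  rw [Timelike, form_sub_eq, sub_pos, mul_self_lt_mul_self_iff (M.len_nonneg _) (abs_nonneg _)]

theorem len_smul {k : ℕ} (c : M.Q) (x : Fin k → M.Q) : M.len (c • x) = |c| * M.len x := by
  rw [← mul_self_inj (M.len_nonneg _) (mul_nonneg (abs_nonneg _) (M.len_nonneg _)),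
    mul_mul_mul_comm, len_mul_self, len_mul_self, abs_mul_abs_self, Finset.mul_sum]
  exact Finset.sum_congr rfl fun i _ => by simp only [Pi.smul_apply, smul_eq_mul]; ring

theorem len_pos {k : ℕ} {x : Fin k → M.Q} {i : Fin k} (h : x i ≠ 0) : 0 < M.len x := by
  refine (M.len_nonneg x).lt_of_ne fun h0 => ?_
  have h1 := M.len_mul_self x
  rw [← h0, mul_zero, eq_comm, Finset.sum_eq_zero_iff_of_nonneg fun i _ => mul_self_nonneg _] at h1
  exact h (mul_self_eq_zero.1 (h1 i (Finset.mem_univ i)))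

theorem AxPh.null_iff (hPh : M.AxPh) {m : M.Body} (hm : m ∈ M.IOb) (p q : M.Pt) :
    Null p q ↔ (M.Ph ∩ M.ev m p ∩ M.ev m q).Nonempty := by
  rw [← hPh m hm, len_eq_iff_null]

theorem AxPh.nonempty_ev (hPh : M.AxPh) {m : M.Body} (hm : m ∈ M.IOb) (p : M.Pt) :
    (M.ev m p).Nonempty := by
  obtain ⟨b, hb⟩ := (hPh.null_iff hm p p).1 (by simp [Null])
  exact ⟨b, hb.2⟩

/-- The photons in an event determine the light cone of its location, hence the location. Thus every
location, time and worldview value needed below is defined. -/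
theorem AxPh.ev_injective (hPh : M.AxPh) (hn : 0 < n) {m : M.Body} (hm : m ∈ M.IOb) :
    Function.Injective (M.ev m) := fun p q h => eq_of_null_iff hn fun r => by
  rw [hPh.null_iff hm, hPh.null_iff hm, h]

theorem AxPh.isLoc (hPh : M.AxPh) (hn : 0 < n) {m : M.Body} (hm : m ∈ M.IOb) (p : M.Pt) :
    M.IsLoc m (M.ev m p) p := ⟨rfl, fun _ h => hPh.ev_injective hn hm h⟩

theorem AxPh.isTime_iff (hPh : M.AxPh) (hn : 0 < n) {m : M.Body} (hm : m ∈ M.IOb) (p : M.Pt)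
    (t : M.Q) : M.IsTime m (M.ev m p) t ↔ t = p 0 := by
  constructor
  · rintro ⟨q, hq, rfl⟩
    rw [hPh.ev_injective hn hm hq.1, tm]
  · rintro rfl
    exact ⟨p, hPh.isLoc hn hm p, rfl⟩

theorem AxPh.isElapsed_iff (hPh : M.AxPh) (hn : 0 < n) {m : M.Body} (hm : m ∈ M.IOb) (p q : M.Pt)
    (t : M.Q) : M.IsElapsed m (M.ev m p) (M.ev m q) t ↔ t = |p 0 - q 0| := by
  simp only [IsElapsed, hPh.isTime_iff hn hm, exists_and_left, exists_eq_left]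

theorem AxEv.exists_ev_eq (hEv : M.AxEv) (hPh : M.AxPh) {m k : M.Body} (hm : m ∈ M.IOb)
    (hk : k ∈ M.IOb) (p : M.Pt) : ∃ q, M.ev k q = M.ev m p := by
  have h : M.ev m p ∈ M.Ev m := ⟨hPh.nonempty_ev hm p, p, rfl⟩
  rw [hEv m hm k hk] at h
  exact h.2

/-- The worldview transformation between inertial observers is a bijection which preserves being
connectible by a photon. -/
theorem exists_worldview_map (hPh : M.AxPh) (hEv : M.AxEv) (hn : 0 < n) {m k : M.Body}
    (hm : m ∈ M.IOb) (hk : k ∈ M.IOb) :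
    ∃ f : M.Pt → M.Pt, Function.Surjective f ∧ (∀ p q, Null p q ↔ Null (f p) (f q)) ∧
      ∀ p, M.ev k (f p) = M.ev m p := by
  choose f hf using hEv.exists_ev_eq hPh hm hk
  refine ⟨f, fun q => ?_, fun p q => ?_, hf⟩
  · obtain ⟨p, hp⟩ := hEv.exists_ev_eq hPh hk hm q
    exact ⟨p, hPh.ev_injective hn hk (by rw [hf, hp])⟩
  · rw [hPh.null_iff hm, hPh.null_iff hk, hf, hf]

theorem AxSelf0.mem_ev_iff (hSelf : M.AxSelf0) (hPh : M.AxPh) {k : M.Body} (hk : k ∈ M.IOb)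
    (p : M.Pt) : k ∈ M.ev k p ↔ M.sp p = 0 := by
  rw [hSelf k (M.iob_subset hk)]
  exact and_iff_right (hPh.nonempty_ev hk p)

theorem eq_of_sp_eq_zero {p q : M.Pt} (hp : M.sp p = 0) (hq : M.sp q = 0) (h : p 0 = q 0) :
    p = q := by
  funext i
  exact Fin.cases h (fun j => (congrFun hp j).trans (congrFun hq j).symm) i

/-- Distinct events on the world-line of an inertial observer are timelike separated. -/
theorem timelike_of_mem_ev (hSelf : M.AxSelf0) (hPh : M.AxPh) (hEv : M.AxEv) (hn : 2 ≤ n)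
    {m a : M.Body} (hm : m ∈ M.IOb) (ha : a ∈ M.IOb) {p q : M.Pt} (hp : a ∈ M.ev m p)
    (hq : a ∈ M.ev m q) (hne : p ≠ q) : Timelike p q := by
  obtain ⟨f, hf, hnull, hev⟩ := exists_worldview_map hPh hEv (by omega) hm ha
  have hinj := injective_of_null (by omega) hnull
  -- In the coordinates of `a` itself both points lie on the time axis.
  rw [timelike_transfer M.exists_sqrt hn hf hnull, ← len_lt_iff_timelike]
  rw [← hev, hSelf.mem_ev_iff hPh ha] at hp hq
  rw [hp, hq, sub_self, ← zero_smul M.Q (0 : Fin n → M.Q), len_smul, abs_zero, zero_mul, abs_pos,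
    sub_ne_zero]
  exact fun h => hne (hinj (eq_of_sp_eq_zero hp hq h))

/-- In a clock paradox situation observed by some inertial observer, the middle event is causally
between the other two events according to every inertial observer. -/
theorem CPSituation.exists_between (hSelf : M.AxSelf0) (hPh : M.AxPh) (hEv : M.AxEv) (hn : 2 ≤ n)
    {m a b c k : M.Body} (hm : m ∈ M.IOb) (ha : a ∈ M.IOb) (hc : c ∈ M.IOb) (hk : k ∈ M.IOb)
    {ea e ec : M.Event} (hea : ea ∈ M.Ev m) (he : e ∈ M.Ev m) (hec : ec ∈ M.Ev m)
    (h : M.CPSituation m a b c ea e ec) :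
    ∃ x y z, M.ev k x = ea ∧ M.ev k y = e ∧ M.ev k z = ec ∧ Between x y z := by
  obtain ⟨-, x, rfl⟩ := hea
  obtain ⟨-, y, rfl⟩ := he
  obtain ⟨-, z, rfl⟩ := hec
  obtain ⟨hax, -, hcy, -, ta, t, tc, hta, ht, htc, hlt⟩ := h
  rw [hPh.isTime_iff (by omega) hm] at hta ht htc
  subst hta ht htc
  have hxy : x ≠ y := by rintro rfl; simp at hlt
  have hzy : z ≠ y := by rintro rfl; simp at hlt
  obtain ⟨f, hf, hnull, hev⟩ := exists_worldview_map hPh hEv (by omega) hm hk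
  exact ⟨f x, f y, f z, hev x, hev y, hev z, between_transfer M.exists_sqrt hn hf hnull
    (timelike_of_mem_ev hSelf hPh hEv hn hm ha hax.1 hax.2 hxy)
    (timelike_of_mem_ev hSelf hPh hEv hn hm hc hcy.2 hcy.1 hzy) hlt⟩

/-! ### From slow clocks to the clock paradox -/

theorem IsTimeUnit.unique {k m : M.Body} {x y : M.Pt} (hx : M.IsTimeUnit k m x)
    (hy : M.IsTimeUnit k m y) : x = y := by
  obtain ⟨u₁, u₀, h₁, h₀, rfl⟩ := hx
  obtain ⟨v₁, v₀, k₁, k₀, rfl⟩ := hy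
  rw [h₁.2 v₁ k₁.1, h₀.2 v₀ k₀.1]

/-- The clock of a relatively moving inertial observer shows less elapsed time. -/
theorem exists_isElapsed_lt (hLin : M.AxLinTime) (hSlow : M.SlowTime) {b a : M.Body} (hb : b ∈ M.IOb) (ha : a ∈ M.IOb)
    {p q : M.Pt} (hp : a ∈ M.ev b p) (hq : a ∈ M.ev b q) (hpq : p 0 ≠ q 0)
    (hne : M.wl b a ≠ M.wl b b) :
    ∃ r, M.IsElapsed a (M.ev b p) (M.ev b q) r ∧ r < |p 0 - q 0| := by
  obtain ⟨q₀, x, -, hx, hwl, htime⟩ := hLin b hb a ha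
  obtain ⟨r, hr, hrx⟩ := htime p hp q hq
  refine ⟨r, hr, ?_⟩
  obtain ⟨x', hx', hlt⟩ := hSlow b hb a ha hne
  obtain rfl := hx'.unique hx
  have hp' : p ∈ M.wl b a := hp
  have hq' : q ∈ M.wl b a := hq
  rw [hwl] at hp' hq'
  obtain ⟨s, rfl⟩ := hp'
  obtain ⟨t, rfl⟩ := hq'
  have hlt : 1 < |x' 0| := hlt
  have hx0 : x' 0 ≠ 0 := fun h => by rw [h, abs_zero] at hlt; exact absurd hlt (by norm_num)
  have hst : s ≠ t := by rintro rfl; exact hpq rfl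
  -- Cancelling the length of the time unit leaves `r = |s - t|`, while the coordinate time is `|s -
  -- t| * |x' 0|`.
  rw [add_sub_add_left_eq_sub, ← sub_smul, len_smul, mul_left_inj' (len_pos hx0).ne'] at hrx
  have : (q₀ + s • x') 0 - (q₀ + t • x') 0 = (s - t) * x' 0 := by
    simp only [Pi.add_apply, Pi.smul_apply, smul_eq_mul]; ring
  rw [this, hrx, abs_mul]
  exact lt_mul_of_one_lt_right (abs_pos.2 (sub_ne_zero.2 hst)) hlt

theorem cp_of_slowTime (hSelf : M.AxSelf0) (hPh : M.AxPh) (hEv : M.AxEv) (hLin : M.AxLinTime)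
    (hSlow : M.SlowTime) (hn : 2 ≤ n) : M.CP := by
  intro m hm c hc a ha b hb e he ea hea ec hec hcp
  have hn0 : 0 < n := by omega
  obtain ⟨x, y, z, rfl, rfl, rfl, hbet⟩ :=
    hcp.exists_between hSelf hPh hEv hn hm ha hc hb hea he hec
  obtain ⟨ha', hb', hc', hbe, -⟩ := hcp
  have hne : ∀ k, k ∈ M.ev b y → M.wl b k ≠ M.wl b b := fun k hk h => by
    have : y ∈ M.wl b k := hk
    rw [h] at this
    exact hbe this
  have hxy : x 0 ≠ y 0 := by rcases hbet with h | h; exacts [h.1.ne, h.1.ne']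
  have hyz : y 0 ≠ z 0 := by rcases hbet with h | h; exacts [h.2.ne, h.2.ne']
  obtain ⟨r, hr, hr'⟩ := exists_isElapsed_lt hLin hSlow hb ha ha'.1 ha'.2 hxy
    (hne a ha'.2)
  obtain ⟨s, hs, hs'⟩ := exists_isElapsed_lt hLin hSlow hb hc hc'.1 hc'.2 hyz
    (hne c hc'.1)
  refine ⟨r, s, |x 0 - z 0|, hr, hs, (hPh.isElapsed_iff hn0 hb x z _).2 rfl, ?_⟩
  refine (add_lt_add hr' hs').trans_eq ?_
  rcases hbet with h | h
  · rw [abs_of_neg (sub_neg.2 h.1), abs_of_neg (sub_neg.2 h.2),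
      abs_of_neg (sub_neg.2 (h.1.trans h.2))]
    ring
  · rw [abs_of_pos (sub_pos.2 h.1), abs_of_pos (sub_pos.2 h.2),
      abs_of_pos (sub_pos.2 (h.2.trans h.1))]
    ring

end FrameModel

/-! ### A model of the clock paradox without slowing down of clocks -/

namespace Minkowski

variable {n : ℕ}

/-- A strict reverse triangle inequality for the modified proper time
`form v v / |v 0| = |v 0| - ‖v_s‖² / |v 0|`. -/
theorem form_div_add_lt {v w : Fin (n + 1) → ℝ} (h : (0 < v 0 ∧ 0 < w 0) ∨ (v 0 < 0 ∧ w 0 < 0))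
    (hne : w 0 • v ≠ v 0 • w) :
    form v v / |v 0| + form w w / |w 0| < form (v + w) (v + w) / |(v + w) 0| := by
  wlog hpos : 0 < v 0 ∧ 0 < w 0 generalizing v w
  · have h' := h.resolve_left hpos
    have := this (v := -v) (w := -w) (Or.inl (by simpa using h')) (by simpa using hne)
      (by simpa using h')
    rw [← neg_add] at this
    simpa only [Pi.neg_apply, abs_neg, map_neg, LinearMap.neg_apply, neg_neg] using this
  obtain ⟨hv, hw⟩ := hpos
  -- The vector is nonzero with time component zero, so it is spacelike; clearing denominators
  -- reduces the goal to exactly this inequality.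
  have hlt : form (w 0 • v - v 0 • w) (w 0 • v - v 0 • w) < 0 := by
    by_contra! hc
    exact hne (sub_eq_zero.1 (eq_zero_of_form_self (by simp [mul_comm]) hc))
  rw [form_sub_self, form_smul_self, form_smul_self, map_smul, map_smul] at hlt
  simp only [LinearMap.smul_apply, smul_eq_mul] at hlt
  rw [Pi.add_apply, abs_of_pos hv, abs_of_pos hw, abs_of_pos (add_pos hv hw), form_add_self,
    div_add_div _ _ hv.ne' hw.ne', div_lt_div_iff₀ (mul_pos hv hw) (add_pos hv hw)]
  nlinarith

/-- There is a Lorentz transformation taking the time axis to any given timelike direction. -/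
theorem exists_lorentz {u : Fin (n + 1) → ℝ} (hu : form u u = 1) (h0 : 0 < u 0) :
    ∃ B : (Fin (n + 1) → ℝ) ≃ₗ[ℝ] (Fin (n + 1) → ℝ),
      (∀ x y, form (B x) (B y) = form x y) ∧ B (Pi.single 0 1) = u := by
  set e : Fin (n + 1) → ℝ := Pi.single 0 1 with he
  set w := u + e with hw
  have hue : form u e = u 0 := form_single_zero u
  have hee : form e e = 1 := by rw [he, form_single_zero]; simp
  have hww : form w w = 2 * (1 + u 0) := by
    rw [hw, form_add_self, hu, hue, hee]; ring
  have hew : form e w = 1 + u 0 := by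
    rw [hw, map_add, hee, form_comm, hue]; ring
  have hww0 : form w w ≠ 0 := by rw [hww]; positivity
  -- The involution fixing `w = u + e` and negating its orthogonal complement; as `e` and `u` have
  -- equal square, it interchanges them.
  set B : (Fin (n + 1) → ℝ) →ₗ[ℝ] (Fin (n + 1) → ℝ) :=
    -LinearMap.id + (2 / form w w) • (form.flip w).smulRight w with hB
  have hBx : ∀ x, B x = -x + (2 / form w w * form x w) • w := by
    intro x
    simp [hB, mul_smul]
  have hBw : ∀ x, form (B x) w = form x w := by
    intro x
    rw [hBx, LinearMap.map_add₂, LinearMap.map_smul₂, LinearMap.map_neg₂, smul_eq_mul]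
    field_simp
    ring
  refine ⟨LinearEquiv.ofInvolutive B fun x => ?_, fun x y => ?_, ?_⟩
  · rw [hBx (B x), hBw, hBx x]; module
  · change form (B x) (B y) = form x y
    rw [hBx y, map_add, map_smul, hBw, map_neg, hBx x, map_add, LinearMap.add_apply, map_smul,
      map_neg, LinearMap.neg_apply, LinearMap.smul_apply, smul_eq_mul, smul_eq_mul, form_comm w y]
    ring
  · change B e = u
    rw [hBx, hew, hww, hw]
    have : 2 / (2 * (1 + u 0)) * (1 + u 0) = 1 := by field_simp
    rw [this]
    module

/-! ### Coordinate frames of the countermodel -/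

/-- Coordinate systems which are similar to the standard one in the sense of Minkowski geometry
and whose unit of time is determined by the modified proper time. -/
structure ClockFrame (n : ℕ) where
  /-- the linear part of the map from coordinates to spacetime -/
  lin : (Fin (n + 1) → ℝ) ≃ₗ[ℝ] (Fin (n + 1) → ℝ)
  /-- the origin -/
  origin : Fin (n + 1) → ℝ
  /-- the scaling factor of the Minkowski form -/
  scale : ℝ
  scale_pos : 0 < scale
  form_lin : ∀ x y, form (lin x) (lin y) = scale * form x y
  -- The image of the time unit has square `scale`, so this says that its modified proper time is
  -- `1`.
  abs_time : |lin (Pi.single 0 1) 0| = scale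

namespace ClockFrame

/-- The map from coordinates to spacetime. -/
def act (F : ClockFrame n) (p : Fin (n + 1) → ℝ) : Fin (n + 1) → ℝ := F.lin p + F.origin

/-- The map from spacetime to coordinates. -/
def coord (F : ClockFrame n) (x : Fin (n + 1) → ℝ) : Fin (n + 1) → ℝ := F.lin.symm (x - F.origin)

@[simp] theorem act_coord (F : ClockFrame n) (x : Fin (n + 1) → ℝ) : F.act (F.coord x) = x := by
  simp [act, coord]

@[simp] theorem coord_act (F : ClockFrame n) (x : Fin (n + 1) → ℝ) : F.coord (F.act x) = x := by
  simp [act, coord]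

theorem act_injective (F : ClockFrame n) : Function.Injective F.act :=
  Function.LeftInverse.injective F.coord_act

theorem act_sub (F : ClockFrame n) (p q : Fin (n + 1) → ℝ) : F.act p - F.act q = F.lin (p - q) := by
  simp [act]

theorem form_act (F : ClockFrame n) (p q : Fin (n + 1) → ℝ) :
    form (F.act p - F.act q) (F.act p - F.act q) = F.scale * form (p - q) (p - q) := by
  rw [act_sub, form_lin]

/-- The points of the time axis of `F`. -/
def axis (F : ClockFrame n) (t : ℝ) : Fin (n + 1) → ℝ := F.act (t • Pi.single 0 1)

theorem axis_eq (F : ClockFrame n) (t : ℝ) :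
    F.axis t = F.origin + t • F.lin (Pi.single 0 1) := by
  rw [axis, act, map_smul, add_comm (t • _)]

variable (n) in
/-- The standard coordinate system. -/
def std : ClockFrame n where
  lin := LinearEquiv.refl ℝ _
  origin := 0
  scale := 1
  scale_pos := one_pos
  form_lin := by simp
  abs_time := by simp

@[simp] theorem std_act (x : Fin (n + 1) → ℝ) : (std n).act x = x := by simp [act, std]

theorem exists_lin_eq {v : Fin (n + 1) → ℝ} (hv : 0 < form v v) (a : Fin (n + 1) → ℝ) :
    ∃ F : ClockFrame n, F.origin = a ∧ ∃ c : ℝ, c ≠ 0 ∧ F.lin (Pi.single 0 1) = c • v := by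
  wlog h0 : 0 < v 0 generalizing v
  · have h1 : 0 < (-v) 0 := by
      simpa using lt_of_le_of_ne (not_lt.1 h0) (time_ne_zero_of_pos hv)
    obtain ⟨F, hF, c, hc, h⟩ := this (v := -v) (by simpa using hv) h1
    exact ⟨F, hF, -c, neg_ne_zero.2 hc, by rw [h]; simp⟩
  set r := √(form v v) with hr
  have hr0 : 0 < r := Real.sqrt_pos.2 hv
  have hrr : r * r = form v v := Real.mul_self_sqrt hv.le
  have hu : form (r⁻¹ • v) (r⁻¹ • v) = 1 := by
    rw [form_smul_self, ← hrr]; field_simp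
  have hs : 0 < r⁻¹ * v 0 := by positivity
  obtain ⟨B, hB, hBe⟩ := exists_lorentz hu hs
  -- Scaling `B` by `s` multiplies the form by `s * s` and gives the time unit the time component `s
  -- * (r⁻¹ * v 0)`; `abs_time` therefore forces `s = r⁻¹ * v 0`.
  refine ⟨{ lin := B.trans (LinearEquiv.smulOfNeZero ℝ _ (r⁻¹ * v 0) hs.ne')
            origin := a
            scale := (r⁻¹ * v 0) * (r⁻¹ * v 0)
            scale_pos := mul_pos hs hs
            form_lin := fun x y => ?_
            abs_time := ?_ }, rfl, (r⁻¹ * v 0) * r⁻¹, by positivity, ?_⟩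
  · simp [hB, mul_assoc]
  · simp [hBe, abs_of_pos h0, abs_of_pos hr0]
    ring
  · simp [hBe, smul_smul, mul_comm]

end ClockFrame

end Minkowski

namespace FrameModel

open Minkowski

variable {n : ℕ}

/-! ### The countermodel and its axioms -/

/-- The bodies of the model: inertial observers and photons. -/
abbrev ClockBody (n : ℕ) : Type := ClockFrame n ⊕ ((Fin (n + 1) → ℝ) × (Fin (n + 1) → ℝ))

/-- The world-line of an observer is its time axis, that of a photon `(x, v)` is the line through
`x` with direction `v`. -/
def worldLine : ClockBody n → Set (Fin (n + 1) → ℝ)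
  | .inl F => {x | ∃ t, x = F.axis t}
  | .inr (y, v) => {x | ∃ t : ℝ, x = y + t • v}

variable (n) in
/-- Minkowski spacetime over the reals, with clocks showing the modified proper time. -/
@[reducible] noncomputable def clockModel : FrameModel.{0, 0} n where
  Q := ℝ
  exists_sqrt x hx := ⟨√x, Real.mul_self_sqrt hx.le⟩
  Body := ClockBody n
  Ob := Set.range Sum.inl
  IOb := Set.range Sum.inl
  Ph := Sum.inr '' {y | form y.2 y.2 = 0}
  iob_subset := subset_rfl
  W m b p := ∃ F, m = .inl F ∧ F.act p ∈ worldLine b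
  w_observer := by
    rintro m b p ⟨F, rfl, -⟩
    exact ⟨F, rfl⟩

/-- The set of bodies passing through a point. -/
def through (x : Fin (n + 1) → ℝ) : Set (ClockBody n) := {b | x ∈ worldLine b}

theorem clockModel_ev (F : ClockFrame n) (p : Fin (n + 1) → ℝ) :
    (clockModel n).ev (.inl F) p = through (F.act p) := by
  ext b
  simp [ev, through]

theorem mem_ev_inl (F G : ClockFrame n) (p : Fin (n + 1) → ℝ) :
    (Sum.inl G : ClockBody n) ∈ (clockModel n).ev (.inl F) p ↔ ∃ t, F.act p = G.axis t := by
  rw [clockModel_ev]; rfl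

theorem clockModel_axPh : (clockModel n).AxPh := by
  rintro _ ⟨F, rfl⟩ p q
  rw [len_eq_iff_null, clockModel_ev, clockModel_ev]
  have h : Null p q ↔ Null (F.act p) (F.act q) := by
    rw [Null, Null, F.form_act, mul_eq_zero, or_iff_right F.scale_pos.ne']
  refine h.trans ⟨fun h => ?_, ?_⟩
  · refine ⟨.inr (F.act p, F.act q - F.act p), ⟨⟨_, ?_, rfl⟩, ⟨0, ?_⟩⟩, ⟨1, ?_⟩⟩
    · rw [Set.mem_ofPred_eq, form_sub_swap]; exact h
    · simp
    · simp
  · rintro ⟨_, ⟨⟨⟨y, v⟩, hv, rfl⟩, ⟨s, hs⟩⟩, ⟨t, ht⟩⟩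
    have hv : form v v = 0 := hv
    rw [hs, ht, Null, add_sub_add_left_eq_sub, ← sub_smul, form_smul_self, hv, mul_zero]

theorem clockModel_axSelf0 : (clockModel n).AxSelf0 := by
  rintro _ ⟨F, rfl⟩ p
  have h : p ∈ (clockModel n).Cd (.inl F) := clockModel_axPh.nonempty_ev ⟨F, rfl⟩ p
  rw [mem_ev_inl, and_iff_right h]
  constructor
  · rintro ⟨t, ht⟩
    rw [F.act_injective ht]
    funext i
    simp [sp]
  · intro hp
    refine ⟨p 0, congrArg F.act ?_⟩
    funext i
    refine Fin.cases ?_ (fun j => ?_) i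
    · simp
    · simpa [sp] using congrFun hp j

theorem clockModel_axEv : (clockModel n).AxEv := by
  have h : ∀ F : ClockFrame n,
      (clockModel n).Ev (.inl F) = {e | e.Nonempty ∧ ∃ x, through x = e} := by
    intro F
    ext e
    refine and_congr Iff.rfl ⟨?_, ?_⟩
    · rintro ⟨p, rfl⟩
      exact ⟨F.act p, (clockModel_ev F p).symm⟩
    · rintro ⟨x, rfl⟩
      exact ⟨F.coord x, by rw [clockModel_ev, F.act_coord]⟩
  rintro _ ⟨F, rfl⟩ _ ⟨G, rfl⟩
  rw [h, h]

theorem clockModel_isWv (hn : 0 < n) (F G : ClockFrame n) (p : Fin (n + 1) → ℝ) :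
    (clockModel n).IsWv (.inl G) (.inl F) p (F.coord (G.act p)) := by
  have h : (clockModel n).ev (.inl G) p = (clockModel n).ev (.inl F) (F.coord (G.act p)) := by
    rw [clockModel_ev, clockModel_ev, F.act_coord]
  refine ⟨⟨h, clockModel_axPh.nonempty_ev ⟨G, rfl⟩ p⟩, fun q hq => ?_⟩
  exact clockModel_axPh.ev_injective hn ⟨F, rfl⟩ (hq.1.symm.trans h)

theorem clockModel_isTimeUnit (hn : 0 < n) (F G : ClockFrame n) :
    (clockModel n).IsTimeUnit (.inl G) (.inl F) (F.lin.symm (G.lin (Pi.single 0 1))) := by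
  refine ⟨_, _, clockModel_isWv hn F G _, clockModel_isWv hn F G _, ?_⟩
  rw [ClockFrame.coord, ClockFrame.coord, ← map_sub, sub_sub_sub_cancel_right, ClockFrame.act_sub,
    sub_zero]
  rfl

theorem clockModel_isElapsed (hn : 0 < n) (G : ClockFrame n) (s t : ℝ) :
    (clockModel n).IsElapsed (.inl G) (through (G.axis s)) (through (G.axis t)) |s - t| := by
  have h := (clockModel_axPh.isElapsed_iff hn (m := (.inl G : ClockBody n)) ⟨G, rfl⟩
    (s • Pi.single 0 1) (t • Pi.single 0 1) |s - t|).2 (by simp)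
  rwa [clockModel_ev, clockModel_ev] at h

theorem clockModel_axLinTime (hn : 0 < n) : (clockModel n).AxLinTime := by
  rintro _ ⟨F, rfl⟩ _ ⟨G, rfl⟩
  have hax : ∀ c : ℝ, F.act (F.coord (G.act 0) + c • F.lin.symm (G.lin (Pi.single 0 1)))
      = G.axis c := by
    intro c
    rw [G.axis_eq, ClockFrame.act, ClockFrame.coord, map_add, map_smul,
      LinearEquiv.apply_symm_apply, LinearEquiv.apply_symm_apply, ClockFrame.act, map_zero]
    module
  have hwl : (clockModel n).wl (.inl F) (.inl G) = {p | ∃ c : ℝ,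
      p = F.coord (G.act 0) + c • F.lin.symm (G.lin (Pi.single 0 1))} := by
    ext p
    refine (mem_ev_inl F G p).trans (exists_congr fun c => ?_)
    rw [← hax, F.act_injective.eq_iff]
  refine ⟨_, _, clockModel_isWv hn F G 0, clockModel_isTimeUnit hn F G, hwl, ?_⟩
  rw [hwl]
  rintro _ ⟨s, rfl⟩ _ ⟨t, rfl⟩
  refine ⟨|s - t|, ?_, ?_⟩
  · rw [clockModel_ev, clockModel_ev, hax, hax]
    exact clockModel_isElapsed hn G s t
  · rw [add_sub_add_left_eq_sub, ← sub_smul]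
    exact (len_smul (M := clockModel n) (s - t) _).symm

theorem clockModel_axShift (hn : 0 < n) : (clockModel n).AxShift := by
  rintro _ ⟨F, rfl⟩ _ ⟨G, rfl⟩ p -
  -- Time units depend only on the linear part, so translating the frame preserves them.
  refine ⟨.inl { G with origin := F.act p }, ⟨_, rfl⟩, ?_, _, clockModel_isTimeUnit hn F G,
    clockModel_isTimeUnit hn F { G with origin := F.act p }⟩
  rw [mem_ev_inl]
  exact ⟨0, by simp [ClockFrame.axis_eq]⟩

theorem clockModel_axThExp : (clockModel n).AxThExp := by
  rintro _ ⟨F, rfl⟩ p q h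
  rw [len_lt_iff_timelike] at h
  have h' : 0 < form (F.act q - F.act p) (F.act q - F.act p) := by
    rw [F.form_act]
    exact mul_pos F.scale_pos h.symm
  obtain ⟨G, hG, c, hc, hGc⟩ := ClockFrame.exists_lin_eq h' (F.act p)
  refine ⟨.inl G, ⟨G, rfl⟩, (mem_ev_inl F G p).2 ⟨0, ?_⟩, (mem_ev_inl F G q).2 ⟨c⁻¹, ?_⟩⟩
  · simp [G.axis_eq, hG]
  · rw [G.axis_eq, hGc, smul_smul, inv_mul_cancel₀ hc, hG]; simp

/-! ### The clock paradox without slow clocks -/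

/-- The clocks of the model show the modified proper time. -/
theorem clockModel_isElapsed_form (hn : 0 < n) {F : ClockFrame n} {x y : Fin (n + 1) → ℝ}
    (hx : Sum.inl F ∈ through x) (hy : Sum.inl F ∈ through y) (h : (x - y) 0 ≠ 0) :
    (clockModel n).IsElapsed (.inl F) (through x) (through y)
      (form (x - y) (x - y) / |(x - y) 0|) := by
  obtain ⟨s, rfl⟩ := hx
  obtain ⟨t, rfl⟩ := hy
  have hst : F.axis s - F.axis t = (s - t) • F.lin (Pi.single 0 1) := by
    rw [F.axis_eq, F.axis_eq]; module
  have hs : s - t ≠ 0 := fun h0 => h (by rw [hst, h0]; simp)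
  convert clockModel_isElapsed hn F s t using 1
  have hS := F.scale_pos
  rw [hst, form_smul_self, F.form_lin, Pi.smul_apply, smul_eq_mul, abs_mul, F.abs_time,
    form_single_zero, Pi.single_eq_same, mul_one, ← abs_mul_abs_self (s - t)]
  have := abs_pos.2 hs
  field_simp

theorem clockModel_cp (hn : 2 ≤ n) : (clockModel n).CP := by
  rintro m hm _ ⟨C, rfl⟩ _ ⟨A, rfl⟩ _ ⟨B, rfl⟩ e he ea hea ec hec hcp
  have hn0 : 0 < n := by omega
  -- Betweenness is moved to the standard frame, because the modified proper time refers to the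
  -- standard time component.
  obtain ⟨x, y, z, rfl, rfl, rfl, hbet⟩ := hcp.exists_between clockModel_axSelf0 clockModel_axPh
    clockModel_axEv hn hm ⟨A, rfl⟩ ⟨C, rfl⟩ (k := .inl (ClockFrame.std n)) ⟨_, rfl⟩ hea he hec
  obtain ⟨ha, hb, hc, hbe, -⟩ := hcp
  simp only [clockModel_ev, ClockFrame.std_act] at ha hb hc hbe ⊢
  have hsgn : (0 < (x - y) 0 ∧ 0 < (y - z) 0) ∨ ((x - y) 0 < 0 ∧ (y - z) 0 < 0) := by
    simpa only [Pi.sub_apply, sub_pos, sub_neg] using hbet.symm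
  have hxz : (x - y) + (y - z) = x - z := sub_add_sub_cancel x y z
  have hxy0 : (x - y) 0 ≠ 0 := by rcases hsgn with h | h; exacts [h.1.ne', h.1.ne]
  have hyz0 : (y - z) 0 ≠ 0 := by rcases hsgn with h | h; exacts [h.2.ne', h.2.ne]
  have hxz0 : (x - z) 0 ≠ 0 := by
    rw [← hxz, Pi.add_apply]
    rcases hsgn with h | h
    exacts [(add_pos h.1 h.2).ne', (add_neg h.1 h.2).ne]
  refine ⟨_, _, _, clockModel_isElapsed_form hn0 ha.1 ha.2 hxy0,
    clockModel_isElapsed_form hn0 hc.1 hc.2 hyz0, clockModel_isElapsed_form hn0 hb.1 hb.2 hxz0, ?_⟩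
  -- If the two legs were parallel, `y` would lie on the line through `x` and `z`, which is the
  -- world-line of `B`.
  have hlt := form_div_add_lt hsgn fun h => hbe ?_
  · rwa [hxz] at hlt
  · obtain ⟨⟨s, hs⟩, ⟨t, ht⟩⟩ := hb
    have h1 : (x - z) 0 • (x - y) = (x - y) 0 • (x - z) := by
      rw [← hxz, Pi.add_apply, add_smul, h, smul_add]
    have h2 : x - y = ((x - y) 0 / (x - z) 0) • (x - z) := by
      rw [div_eq_inv_mul, mul_smul, ← h1, inv_smul_smul₀ hxz0]
    set c := (x - y) 0 / (x - z) 0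
    refine ⟨s - c * (s - t), ?_⟩
    have h3 : y = x - c • (x - z) := by rw [← h2]; abel
    rw [h3, hs, ht, B.axis_eq, B.axis_eq, B.axis_eq]
    module

theorem clockModel_not_slowTime (hn : 0 < n) : ¬ (clockModel n).SlowTime := by
  intro hslow
  set e : Fin (n + 1) → ℝ := Pi.single 0 1 with he
  set v : Fin (n + 1) → ℝ := e + (1 / 2 : ℝ) • Pi.single (Fin.succ ⟨0, hn⟩) 1 with hv
  have hvv : 0 < form v v := by
    rw [hv, he, form_single_add]
    simp
    norm_num
  obtain ⟨F, -, c, hc, hF⟩ := ClockFrame.exists_lin_eq hvv 0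
  obtain ⟨x, hx, hlt⟩ := hslow (.inl F) ⟨F, rfl⟩ (.inl (ClockFrame.std n)) ⟨_, rfl⟩ fun h => by
    have hmem : ∀ t : ℝ, ∃ s, F.axis t = (ClockFrame.std n).axis s := by
      intro t
      have : t • e ∈ (clockModel n).wl (.inl F) (.inl F) := (mem_ev_inl F F (t • e)).2 ⟨t, rfl⟩
      rw [← h] at this
      exact (mem_ev_inl F _ (t • e)).1 this
    obtain ⟨s, hs⟩ := hmem 0
    obtain ⟨t, ht⟩ := hmem 1
    have h1 : F.axis 1 - F.axis 0 = c • v := by rw [F.axis_eq, F.axis_eq, hF]; module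
    rw [hs, ht, ClockFrame.axis, ClockFrame.axis, ClockFrame.std_act, ClockFrame.std_act] at h1
    have := congrFun h1 (Fin.succ ⟨0, hn⟩)
    simp [hv, he, hc] at this
  rw [hx.unique (clockModel_isTimeUnit hn F (ClockFrame.std n))] at hlt
  change 1 < |F.lin.symm e 0| at hlt
  -- Both sides equal `form e (F.lin e)`. With `abs_time` the time component of the standard unit
  -- seen by `F` is `± 1`, so it is not larger than `1` in absolute value.
  have h1 : F.scale * F.lin.symm e 0 = F.lin e 0 := by
    rw [← form_single_zero (F.lin.symm e), ← F.form_lin, LinearEquiv.apply_symm_apply, form_comm,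
      form_single_zero]
  have h2 : F.scale * |F.lin.symm e 0| = F.scale := by
    rw [← abs_of_pos F.scale_pos, ← abs_mul, h1, F.abs_time, abs_of_pos F.scale_pos]
  have h3 := F.scale_pos
  nlinarith

end FrameModel

theorem mainTheorem8 (n : ℕ) (hd : 3 ≤ n + 1) :
    FrameModel.Entails.{u, v}
        (FrameModel.SpecRel0 n ∪ {FrameModel.AxLinTime, FrameModel.SlowTime})
        FrameModel.CP ∧
      ¬ FrameModel.Entails.{0, 0}
        (FrameModel.SpecRel0 n ∪ {FrameModel.AxLinTime, FrameModel.AxShift, FrameModel.AxThExp,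
          FrameModel.CP})
        FrameModel.SlowTime := by
  have hn : 2 ≤ n := by omega
  refine ⟨fun M hM => ?_, fun h => FrameModel.clockModel_not_slowTime (n := n) (by omega)
    (h (FrameModel.clockModel n) ?_)⟩
  · exact FrameModel.cp_of_slowTime (hM _ (by simp [FrameModel.SpecRel0]))
      (hM _ (by simp [FrameModel.SpecRel0])) (hM _ (by simp [FrameModel.SpecRel0]))
      (hM _ (by simp)) (hM _ (by simp)) hn
  · rintro ψ ((rfl | rfl | rfl) | (rfl | rfl | rfl | rfl))
    · exact FrameModel.clockModel_axSelf0
    · exact FrameModel.clockModel_axPh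
    · exact FrameModel.clockModel_axEv
    · exact FrameModel.clockModel_axLinTime (by omega)
    · exact FrameModel.clockModel_axShift (by omega)
    · exact FrameModel.clockModel_axThExp
    · exact FrameModel.clockModel_cp hn
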